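/- Let $d,N\ge 1$ and, for an integer $L\ge 1$, let $\Lambda=(\mathbb Z/L\mathbb Z)^d$ be the periodic lattice of side length $L$, with positively oriented nearest-neighbour edges $E_\Lambda^+=\{(x,x+e_i): x\in\Lambda,\ 1\le i\le d\}$ and lattice ($\ell^1$) distance $d(\cdot,\cdot)$ on the torus. For $\kappa,m>0$ and a gauge field $Q=(Q_e)_{e\in E_\Lambda^+}\in SO(N)^{E_\Lambda^+}$ let $\mu_Q$ be the probability measure on Higgs fields $\Phi\in(\mathbb R^N)^\Lambda$ (the conditional law of $\Phi$ given $Q$ in the lattice Yang--Mills--Higgs model) $$\mu_Q(d\Phi)=\frac1{Z_Q}\exp\Big(-\kappa N\sum_{e=(x,y)\in E^+_\Lambda}|Q_e\Phi_y-\Phi_x|^2-mN\sum_{z\in\Lambda}|\Phi_z|^2\Big)\prod_{z\in\Lambda}d\Phi_z .$$ For smooth $F:(\mathbb R^N)^\Lambda\to\mathbb R$ let $\Lambda_F$ be the set of sites on which $F$ depends, $\nabla_xF$ the gradient in the variable $\Phi_x$, and $|||F|||_{2,Q}=\sum_{x\in\Lambda}\|\nabla_xF\|_{L^2(\mu_Q)}$.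 For $\beta\in\mathbb R$ put $$K_{\mathcal S}=\frac{N+2}{4}-1-\frac{\kappa N}{m}-\frac{2\kappa^2N}{m^2}-8(d-1)N|\beta| .$$ Then there are constants $C>0$, depending only on $d,N,\kappa,m$, and $C_N>0$, depending only on $d,N$ and $K_{\mathcal S}$, such that for all $\beta\in\mathbb R$ (with no condition on the sign of $K_{\mathcal S}$, hence no smallness condition on $\beta$ or $\kappa$), all $L\ge1$, all $Q$, and all smooth $F,H$ on $(\mathbb R^N)^\Lambda$ with $\Lambda_F\cap\Lambda_H=\emptyset$ and $|||F|||_{2,Q},|||H|||_{2,Q}<\infty$, one has $F,H\in L^2(\mu_Q)$ and $$|\mathrm{cov}_{\mu_Q}(F,H)|\le C\,|\Lambda_F|\,|\Lambda_H|\,e^{-C_N\,d(\Lambda_F,\Lambda_H)}\,|||F|||_{2,Q}\,|||H|||_{2,Q}.$$ (If $\Lambda_F$ or $\Lambda_H$ is empty, $d(\Lambda_F,\Lambda_H)$ is read as $0$ and both sides vanish.) -/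

import Mathlib

open MeasureTheory ProbabilityTheory
open scoped ContDiff

noncomputable section

namespace YMH

/-- The finite lattice of side length `L` in dimension `d` with periodic boundary conditions,
i.e. the discrete torus. -/
abbrev Site (d L : ℕ) : Type := Fin d → ZMod L

/-- Positively oriented nearest neighbour edges: `(x, i)` is the edge from `x` to `x + e_i`. -/
abbrev PosEdge (d L : ℕ) : Type := Site d L × Fin d

/-- Starting point of a positively oriented edge. -/
def PosEdge.src {d L : ℕ} (e : PosEdge d L) : Site d L := e.1

/-- End point of a positively oriented edge. -/
def PosEdge.tgt {d L : ℕ} (e : PosEdge d L) : Site d L := e.1 + Pi.single e.2 1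

/-- A gauge field: an `SO(N)` matrix on every positively oriented edge. -/
abbrev GaugeField (d L N : ℕ) : Type :=
  PosEdge d L → Matrix.specialOrthogonalGroup (Fin N) ℝ

/-- A Higgs field: a vector of the Euclidean space `ℝ^N` at every site. The measure `volume` on
this space is the product of the Lebesgue measures. -/
abbrev HiggsField (d L N : ℕ) : Type := Site d L → EuclideanSpace ℝ (Fin N)

/-- The Higgs part of the action,
`κ N ∑_{e = (x,y)} |Q_e Φ_y - Φ_x|² + m N ∑_z |Φ_z|²`. -/
def higgsAction {d L N : ℕ} [NeZero L] (κ m : ℝ) (Q : GaugeField d L N)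
    (Φ : HiggsField d L N) : ℝ :=
  κ * N * ∑ e : PosEdge d L,
      ‖Matrix.toEuclideanLin (Q e : Matrix (Fin N) (Fin N) ℝ) (Φ e.tgt) - Φ e.src‖ ^ 2
    + m * N * ∑ z : Site d L, ‖Φ z‖ ^ 2

/-- The conditional Higgs measure given the gauge field `Q`: the probability measure on Higgs
fields with density `exp (-S₂(Q, Φ)) / Z_Q` with respect to Lebesgue measure, where `S₂` is the
Higgs part of the action and `Z_Q = ∫ exp (-S₂(Q, Φ)) dΦ`. -/
def higgsMeasure {d L N : ℕ} [NeZero L] (κ m : ℝ) (Q : GaugeField d L N) :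
    Measure (HiggsField d L N) :=
  (volume : Measure (HiggsField d L N)).tilted (fun Φ => -higgsAction κ m Q Φ)

/-- The gradient `∇_x F` of `F` in the variable `Φ_x`. -/
def gradAt {d L N : ℕ} (F : HiggsField d L N → ℝ) (x : Site d L) (Φ : HiggsField d L N) :
    EuclideanSpace ℝ (Fin N) :=
  gradient (fun v : EuclideanSpace ℝ (Fin N) => F (Function.update Φ x v)) (Φ x)

/-- The seminorm `∑_x ‖∇_x F‖_{L²(μ)}`; used only when all the `∇_x F` are in `L²(μ)`. -/
def gradNorm {d L N : ℕ} [NeZero L] (μ : Measure (HiggsField d L N))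
    (F : HiggsField d L N → ℝ) : ℝ :=
  ∑ x : Site d L, (eLpNorm (gradAt F x) 2 μ).toReal

/-- The set `Λ_F` of the sites that `F` depends on. -/
def siteSupport {d L N : ℕ} (F : HiggsField d L N → ℝ) : Set (Site d L) :=
  {x | ∃ (Φ : HiggsField d L N) (v : EuclideanSpace ℝ (Fin N)),
    F (Function.update Φ x v) ≠ F Φ}

/-- The lattice (nearest neighbour, `ℓ¹`) distance on the torus: the distance between two
residues modulo `L` is the least absolute value of a representative of their difference. -/
def siteDist {d L : ℕ} (x y : Site d L) : ℕ :=
  ∑ i : Fin d, (x i - y i).valMinAbs.natAbs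

/-- The lattice distance between two sets of sites (equal to `0` if one of them is empty). -/
def setDist {d L : ℕ} (A B : Set (Site d L)) : ℕ :=
  sInf {n : ℕ | ∃ x ∈ A, ∃ y ∈ B, n = siteDist x y}

/-- The number
`K_S = (N + 2)/4 - 1 - κ N / m - 2 κ² N / m² - 8 (d - 1) N |β|`, of any sign here. -/
def curvConst (d N : ℕ) (β κ m : ℝ) : ℝ :=
  ((N : ℝ) + 2) / 4 - 1 - κ * N / m - 2 * κ ^ 2 * N / m ^ 2 - 8 * ((d : ℝ) - 1) * N * |β|

end YMH

end

/-!
The Higgs action is a positive definite quadratic form, so `higgsMeasure` is a centred Gaussian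
measure `γ` (`higgsMeasure_eq_gaussianOf`), and its covariance operator `T` inverts the bilinear
form `actionForm` of the covariant lattice operator `2 N (κ Δ_Q + m)`.

Let `X, Y` be independent with law `γ` and let `X_θ = cos θ X + sin θ Y`, with velocity
`X'_θ = -sin θ X + cos θ Y`. The pair `(X_θ, X'_θ)` again has law `γ ⊗ γ`
(`measurePreserving_rot`). Since `F Y - F X = ∫ dF(X_θ)(X'_θ) dθ` over `[0, π/2]`, an `L²` gradient
forces `F ∈ L²` (`memLp_sub_prod`, `memLp_of_memLp_fderiv`). The same formula for `H`, followed by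
Gaussian integration by parts in the velocity, gives the covariance identity
`cov(F, H) = ∫ sin θ 𝔼[dF(X) (T dH(X_θ))] dθ` (`covariance_gaussianOf`). Only square integrability
of the gradients enters, so no truncation of `F` and `H` is needed.

It remains to see that `T` decays exponentially. If `actionForm w = ℓ` with `ℓ` carried by
`Λ_H`, then at a site maximizing `t ^ d(z, Λ_H) * ‖w z‖` the neighbours exceed `‖w z‖` at most by
the factor `t`. The transport matrices are isometries, so the `2 d` edge ends at this site cost at most
`4 d κ N (t - 1) ‖w z‖²`, which the mass term absorbs when `4 d κ (t - 1) ≤ m`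
(`pow_mul_norm_le_of_actionForm`). Cauchy-Schwarz on `γ ⊗ γ` turns this into the covariance
bound with the factor `t ^ (-d(Λ_F, Λ_H))`.

Finally, `K_S ≤ (N + 2) / 4 - 1 - κ N / m` bounds `κ / m` in terms of `K_S` and `N`, so that `t > 1`
can be chosen as a function of `d`, `N`, `K_S` alone (`exp_decayRate_sub_one_le`).
-/

namespace YMH

/-! ### Rotations of two copies of a space -/

section Rotation

variable {E : Type*} [NormedAddCommGroup E] [NormedSpace ℝ E] {B : E →L[ℝ] E →L[ℝ] ℝ}

/-- The rotation by the angle `θ` in the plane spanned by the two factors of `E × E`. -/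
noncomputable def rot (θ : ℝ) : E × E →ₗ[ℝ] E × E :=
  (Real.cos θ • LinearMap.fst ℝ E E + Real.sin θ • LinearMap.snd ℝ E E).prod
    (-Real.sin θ • LinearMap.fst ℝ E E + Real.cos θ • LinearMap.snd ℝ E E)

@[simp] theorem rot_apply (θ : ℝ) (p : E × E) :
    rot θ p = (Real.cos θ • p.1 + Real.sin θ • p.2, -Real.sin θ • p.1 + Real.cos θ • p.2) := rfl

theorem rot_neg_rot (θ : ℝ) (p : E × E) : rot (-θ) (rot θ p) = p := by
  have h := Real.cos_sq_add_sin_sq θ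
  ext
  · simp only [rot_apply, Real.cos_neg, Real.sin_neg]
    rw [show Real.cos θ • (Real.cos θ • p.1 + Real.sin θ • p.2)
        + -Real.sin θ • (-Real.sin θ • p.1 + Real.cos θ • p.2)
        = (Real.cos θ ^ 2 + Real.sin θ ^ 2) • p.1 by module, h, one_smul]
  · simp only [rot_apply, Real.cos_neg, Real.sin_neg]
    rw [show - -Real.sin θ • (Real.cos θ • p.1 + Real.sin θ • p.2)
        + Real.cos θ • (-Real.sin θ • p.1 + Real.cos θ • p.2)
        = (Real.cos θ ^ 2 + Real.sin θ ^ 2) • p.2 by module, h, one_smul]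

theorem continuous_rot_uncurry : Continuous (fun q : ℝ × (E × E) => rot q.1 q.2) := by
  simp only [rot_apply]; fun_prop

theorem continuous_rot (θ : ℝ) : Continuous (rot θ : E × E → E × E) := by
  simp only [funext (rot_apply θ)]; fun_prop

/-- The reflection of the second factor conjugates a rotation to its inverse, so the determinant
of a rotation equals its own inverse. -/
theorem det_rot_sq (θ : ℝ) : LinearMap.det (rot θ : E × E →ₗ[ℝ] E × E) ^ 2 = 1 := by
  let S : E × E →ₗ[ℝ] E × E := (LinearMap.fst ℝ E E).prod (-LinearMap.snd ℝ E E)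
  have hSS : S ∘ₗ S = LinearMap.id := by
    apply LinearMap.ext; intro p; ext <;> simp [S]
  have hS : LinearMap.det S * LinearMap.det S = 1 := by
    rw [← LinearMap.det_comp, hSS, LinearMap.det_id]
  have hinv : rot (-θ) ∘ₗ rot θ = (LinearMap.id : E × E →ₗ[ℝ] E × E) :=
    LinearMap.ext (rot_neg_rot θ)
  have hconj : S ∘ₗ rot θ ∘ₗ S = rot (-θ) := by
    apply LinearMap.ext; intro p
    ext <;> simp [S, add_comm]
  have h1 : LinearMap.det (rot (-θ) : E × E →ₗ[ℝ] E × E)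
      = LinearMap.det (rot θ : E × E →ₗ[ℝ] E × E) := by
    rw [← hconj, LinearMap.det_comp, LinearMap.det_comp]
    linear_combination LinearMap.det (rot θ : E × E →ₗ[ℝ] E × E) * hS
  rw [sq]
  nth_rewrite 1 [← h1]
  rw [← LinearMap.det_comp, hinv, LinearMap.det_id]

theorem form_rot (hsym : ∀ v w, B v w = B w v) (θ : ℝ) (p : E × E) :
    B (rot θ p).1 (rot θ p).1 + B (rot θ p).2 (rot θ p).2 = B p.1 p.1 + B p.2 p.2 := by
  simp only [rot_apply, map_add, map_smul, _root_.add_apply,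
    _root_.smul_apply, smul_eq_mul, hsym p.2 p.1]
  linear_combination (B p.1 p.1 + B p.2 p.2) * Real.cos_sq_add_sin_sq θ

end Rotation

/-! ### Centred Gaussian measures given by their inverse covariance -/

section Gaussian

variable {E : Type*} [NormedAddCommGroup E] [NormedSpace ℝ E] [MeasurableSpace E]

/-- The centred Gaussian measure with density proportional to `exp (-B v v / 2)`, where the
bilinear form `B` is the inverse of the covariance. It is a probability measure when `B` is
coercive; when the density is not integrable, `Measure.tilted` makes it `0`. -/
noncomputable def gaussianOf (μ : Measure E) (B : E →L[ℝ] E →L[ℝ] ℝ) : Measure E :=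
  μ.tilted (fun v => -(B v v) / 2)

variable [FiniteDimensional ℝ E] [BorelSpace E]
  {μ : Measure E} [μ.IsAddHaarMeasure] {B : E →L[ℝ] E →L[ℝ] ℝ} {c : ℝ}

theorem one_add_pow_mul_exp_le (k : ℕ) {a t : ℝ} (ha : 0 < a) (ht : 0 ≤ t) :
    (1 + t) ^ k * Real.exp (-(a * t ^ 2)) ≤ k.factorial * Real.exp (1 + 1 / (4 * a)) := by
  have h1 := Real.pow_div_factorial_le_exp (1 + t) (by linarith) k
  have hk : (0 : ℝ) < k.factorial := by positivity
  rw [div_le_iff₀ hk] at h1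
  calc (1 + t) ^ k * Real.exp (-(a * t ^ 2))
      ≤ (Real.exp (1 + t) * k.factorial) * Real.exp (-(a * t ^ 2)) := by gcongr
    _ = k.factorial * Real.exp (1 + t + -(a * t ^ 2)) := by rw [Real.exp_add (1 + t)]; ring
    _ ≤ _ := by
      refine mul_le_mul_of_nonneg_left (Real.exp_le_exp.2 ?_) hk.le
      have : 1 / (4 * a) - t + a * t ^ 2 = a * (t - 1 / (2 * a)) ^ 2 := by field_simp; ring
      nlinarith [mul_nonneg ha.le (sq_nonneg (t - 1 / (2 * a)))]

theorem integrable_norm_pow_mul_exp (hc : 0 < c) (hB : ∀ v, c * ‖v‖ ^ 2 ≤ B v v) (k : ℕ) :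
    Integrable (fun v => ‖v‖ ^ k * Real.exp (-(B v v) / 2)) μ := by
  set n := Module.finrank ℝ E
  have h0 : Integrable (fun v : E => (1 + ‖v‖) ^ (-((n + 1 : ℕ) : ℝ))) μ :=
    integrable_one_add_norm (by push_cast; linarith)
  have hcont : Continuous (fun v => ‖v‖ ^ k * Real.exp (-(B v v) / 2)) := by fun_prop
  -- The Gaussian factor beats any power, so the integrand is `O((1 + ‖v‖) ^ (-(n + 1)))`.
  refine (h0.const_mul ((k + (n + 1)).factorial * Real.exp (1 + 1 / (4 * (c / 2))))).mono'
    hcont.aestronglyMeasurable (Filter.Eventually.of_forall fun v => ?_)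
  have h1 := one_add_pow_mul_exp_le (k + (n + 1)) (half_pos hc) (norm_nonneg v)
  have hp : 0 < 1 + ‖v‖ := by positivity
  rw [Real.norm_of_nonneg (by positivity), Real.rpow_neg hp.le, Real.rpow_natCast,
    ← div_eq_mul_inv, le_div_iff₀ (by positivity)]
  refine le_trans ?_ h1
  rw [pow_add _ k, mul_right_comm _ _ (Real.exp (-(c / 2 * _)))]
  have : Real.exp (-(B v v) / 2) ≤ Real.exp (-(c / 2 * ‖v‖ ^ 2)) := by
    gcongr
    linarith [hB v]
  have h2 : ‖v‖ ^ k ≤ (1 + ‖v‖) ^ k := by gcongr; linarith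
  exact mul_le_mul_of_nonneg_right (mul_le_mul h2 this (Real.exp_pos _).le (by positivity))
    (by positivity)

theorem integrable_exp_neg_form (hc : 0 < c) (hB : ∀ v, c * ‖v‖ ^ 2 ≤ B v v) :
    Integrable (fun v => Real.exp (-(B v v) / 2)) μ := by
  simpa using integrable_norm_pow_mul_exp (μ := μ) hc hB 0

theorem isProbabilityMeasure_gaussianOf (hc : 0 < c) (hB : ∀ v, c * ‖v‖ ^ 2 ≤ B v v) :
    IsProbabilityMeasure (gaussianOf μ B) :=
  isProbabilityMeasure_tilted (integrable_exp_neg_form hc hB)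

variable [SecondCountableTopology E]

theorem memLp_id_gaussianOf (hc : 0 < c) (hB : ∀ v, c * ‖v‖ ^ 2 ≤ B v v) :
    MemLp (fun v : E => v) 2 (gaussianOf μ B) := by
  rw [memLp_two_iff_integrable_sq_norm (by fun_prop)]
  rw [gaussianOf, integrable_tilted_iff (integrable_exp_neg_form hc hB)]
  simpa [mul_comm] using integrable_norm_pow_mul_exp (μ := μ) hc hB 2

theorem measurePreserving_rot_prod (μ : Measure E) [μ.IsAddHaarMeasure] (θ : ℝ) :
    MeasurePreserving (rot θ : E × E → E × E) (μ.prod μ) (μ.prod μ) := by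
  refine ⟨(continuous_rot θ).measurable, ?_⟩
  have h := det_rot_sq (E := E) θ
  have h0 : LinearMap.det (rot θ : E × E →ₗ[ℝ] E × E) ≠ 0 := by
    intro h0; rw [h0] at h; norm_num at h
  have h1 : |LinearMap.det (rot θ : E × E →ₗ[ℝ] E × E)| = 1 := by
    rcases sq_eq_sq_iff_eq_or_eq_neg.1 (h.trans (one_pow 2).symm) with h | h <;> simp [h]
  rw [Measure.map_linearMap_addHaar_eq_smul_addHaar _ h0, abs_inv, h1]
  simp

theorem measurePreserving_rot (hsym : ∀ v w, B v w = B w v) (θ : ℝ) :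
    MeasurePreserving (rot θ : E × E → E × E) ((gaussianOf μ B).prod (gaussianOf μ B))
      ((gaussianOf μ B).prod (gaussianOf μ B)) := by
  refine ⟨(continuous_rot θ).measurable, ?_⟩
  set Z := ∫ v, Real.exp (-(B v v) / 2) ∂μ
  have hm : Measurable fun v : E => ENNReal.ofReal (Real.exp (-(B v v) / 2) / Z) := by
    have : Continuous fun v : E => Real.exp (-(B v v) / 2) / Z := by fun_prop
    exact this.measurable.ennreal_ofReal
  have hprod : (gaussianOf μ B).prod (gaussianOf μ B)
      = (μ.prod μ).withDensity (fun z => ENNReal.ofReal (Real.exp (-(B z.1 z.1) / 2) / Z)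
        * ENNReal.ofReal (Real.exp (-(B z.2 z.2) / 2) / Z)) := by
    rw [← prod_withDensity hm hm]; rfl
  rw [hprod]
  set g : E × E → ENNReal := fun z => ENNReal.ofReal (Real.exp (-(B z.1 z.1) / 2) / Z)
        * ENNReal.ofReal (Real.exp (-(B z.2 z.2) / 2) / Z)
  have hg : Measurable g := (hm.comp measurable_fst).mul (hm.comp measurable_snd)
  have hZ : 0 ≤ Z := integral_nonneg fun v => (Real.exp_pos _).le
  have hginv : ∀ p, g (rot θ p) = g p := by
    intro p
    simp only [g]
    rw [← ENNReal.ofReal_mul (by positivity), ← ENNReal.ofReal_mul (by positivity),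
      div_mul_div_comm, div_mul_div_comm, ← Real.exp_add, ← Real.exp_add]
    congr 3
    linarith [form_rot hsym θ p]
  ext s hs
  have hR := measurePreserving_rot_prod μ θ
  rw [Measure.map_apply hR.measurable hs, withDensity_apply _ hs,
    withDensity_apply _ (hR.measurable hs), ← hR.setLIntegral_comp_preimage hs hg]
  simp only [hginv]

end Gaussian

/-! ### Gaussian interpolation along quarter circles -/

section Calculus

variable {E : Type*} [NormedAddCommGroup E] [NormedSpace ℝ E]

theorem hasDerivAt_rot_fst (p : E × E) (θ : ℝ) :
    HasDerivAt (fun t => (rot t p).1) (rot θ p).2 θ := by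
  simp only [rot_apply]
  exact ((Real.hasDerivAt_cos θ).smul_const p.1).add ((Real.hasDerivAt_sin θ).smul_const p.2)

/-- The quarter circle `θ ↦ (rot θ p).1` runs from `p.1` to `p.2`. -/
theorem integral_fderiv_rot {F : E → ℝ} (hF : ContDiff ℝ 1 F) (p : E × E) :
    ∫ θ in (0 : ℝ)..Real.pi / 2, fderiv ℝ F (rot θ p).1 (rot θ p).2 = F p.2 - F p.1 := by
  have hd : ∀ θ, HasDerivAt (fun t => F (rot t p).1) (fderiv ℝ F (rot θ p).1 (rot θ p).2) θ :=
    fun θ => ((hF.differentiable one_ne_zero _).hasFDerivAt).comp_hasDerivAt θ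
      (hasDerivAt_rot_fst p θ)
  have hdF := hF.continuous_fderiv one_ne_zero
  have hc : Continuous fun θ => fderiv ℝ F (rot θ p).1 (rot θ p).2 := by
    simp only [rot_apply]; fun_prop
  rw [intervalIntegral.integral_eq_sub_of_hasDerivAt (fun θ _ => hd θ)
    (hc.intervalIntegrable _ _)]
  simp

end Calculus

/-- Jensen's inequality for the square, read off from `∫ (g - m)² ≥ 0` for all `m`. -/
theorem sq_integral_le {α : Type*} [MeasurableSpace α] {ν : Measure α} [IsFiniteMeasure ν]
    {g : α → ℝ} (hg : MemLp g 2 ν) : (∫ a, g a ∂ν) ^ 2 ≤ ν.real Set.univ * ∫ a, g a ^ 2 ∂ν := by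
  have hi : Integrable g ν := hg.integrable one_le_two
  have h : ∀ m : ℝ, 0 ≤ ν.real Set.univ * (m * m) + (-2 * ∫ a, g a ∂ν) * m + ∫ a, g a ^ 2 ∂ν := by
    intro m
    have h0 : 0 ≤ ∫ a, (g a - m) ^ 2 ∂ν := integral_nonneg fun a => sq_nonneg _
    have h1 : ∀ a, (g a - m) ^ 2 = g a ^ 2 - (2 * m) * g a + m ^ 2 := fun a => by ring
    simp only [h1] at h0
    rw [integral_add (f := fun a => g a ^ 2 - 2 * m * g a) (g := fun _ => m ^ 2)
      (hg.integrable_sq.sub (hi.const_mul _)) (integrable_const _),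
      integral_sub (f := fun a => g a ^ 2) hg.integrable_sq (hi.const_mul _), integral_const_mul,
      integral_const,
      smul_eq_mul] at h0
    linarith
  have := discrim_le_zero h
  rw [discrim] at this
  nlinarith

section Gaussian

variable {E : Type*} [NormedAddCommGroup E] [NormedSpace ℝ E] [MeasurableSpace E]
  [FiniteDimensional ℝ E] [BorelSpace E] {μ : Measure E} [μ.IsAddHaarMeasure]
  {B : E →L[ℝ] E →L[ℝ] ℝ} {c : ℝ}

/-- Gaussian integration by parts. -/
theorem integral_mul_form_gaussianOf [SecondCountableTopology E]
    (hsym : ∀ v w, B v w = B w v) (hc : 0 < c)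
    (hB : ∀ v, c * ‖v‖ ^ 2 ≤ B v v) {g : E → ℝ} (hg : ContDiff ℝ 1 g)
    (hg2 : MemLp g 2 (gaussianOf μ B)) (w : E)
    (hg' : Integrable (fun v => fderiv ℝ g v w) (gaussianOf μ B)) :
    ∫ v, g v * B w v ∂(gaussianOf μ B) = ∫ v, fderiv ℝ g v w ∂(gaussianOf μ B) := by
  have := isProbabilityMeasure_gaussianOf (μ := μ) hc hB
  have hi := integrable_exp_neg_form (μ := μ) hc hB
  have hlin : MemLp (fun v => B w v) 2 (gaussianOf μ B) :=
    (B w).comp_memLp' (memLp_id_gaussianOf hc hB)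
  have hgB : Integrable (fun v => g v * B w v) (gaussianOf μ B) := hg2.integrable_mul hlin
  have hg1 : Integrable g (gaussianOf μ B) := hg2.integrable one_le_two
  rw [gaussianOf, integrable_tilted_iff hi] at hgB hg1 hg'
  set ρ : E → ℝ := fun v => Real.exp (-(B v v) / 2) with hρ
  have hρd : ∀ v, HasFDerivAt ρ (-(ρ v) • B v) v := by
    intro v
    have h1 : HasFDerivAt (fun v => B v v) _ v := B.hasFDerivAt.clm_apply (hasFDerivAt_id v)
    have h2 := ((h1.const_mul (-1 / 2 : ℝ)).exp)
    have h3 : ρ = fun v => Real.exp ((-1 / 2) * B v v) := by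
      funext v; simp only [hρ]; congr 1; ring
    rw [h3]
    refine h2.congr_fderiv ?_
    ext u
    simp [hsym u v]
    ring
  have hρw : ∀ v, fderiv ℝ ρ v w = -(B w v * ρ v) := by
    intro v; rw [(hρd v).fderiv]; simp [hsym v w]; ring
  have key := integral_mul_fderiv_eq_neg_fderiv_mul_of_integrable (μ := μ) (f := g) (g := ρ)
    (v := w) (by simpa [mul_comm] using hg')
    (by simp only [hρw]; refine hgB.neg.congr (Filter.Eventually.of_forall fun v => ?_)
        simp; ring) (by simpa [mul_comm] using hg1)
    (fun x _ => hg.differentiable one_ne_zero x) (fun x _ => (hρd x).differentiableAt)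
  rw [gaussianOf, integral_tilted, integral_tilted]
  simp only [hρw, smul_eq_mul, div_mul_eq_mul_div, integral_div] at key ⊢
  congr 1
  calc ∫ v, ρ v * (g v * B w v) ∂μ = - ∫ v, g v * -(B w v * ρ v) ∂μ := by
        rw [← integral_neg]; congr 1; funext v; ring
    _ = ∫ v, ρ v * fderiv ℝ g v w ∂μ := by
        rw [key, neg_neg]; congr 1; funext v; ring

variable [SecondCountableTopology E]

theorem memLp_fderiv_apply_prod (hc : 0 < c) (hB : ∀ v, c * ‖v‖ ^ 2 ≤ B v v) {F : E → ℝ}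
    (hF : ContDiff ℝ 1 F) (hF2 : MemLp (fderiv ℝ F) 2 (gaussianOf μ B)) :
    MemLp (fun q : E × E => fderiv ℝ F q.1 q.2) 2
      ((gaussianOf μ B).prod (gaussianOf μ B)) := by
  have := isProbabilityMeasure_gaussianOf (μ := μ) hc hB
  have hdF := hF.continuous_fderiv one_ne_zero
  have hcont : Continuous fun q : E × E => fderiv ℝ F q.1 q.2 := by fun_prop
  rw [memLp_two_iff_integrable_sq hcont.aestronglyMeasurable]
  have hid := (memLp_id_gaussianOf (μ := μ) hc hB)
  refine (hF2.integrable_norm_pow two_ne_zero |>.mul_prod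
    (hid.integrable_norm_pow two_ne_zero)).mono' (hcont.pow 2).aestronglyMeasurable
    (Filter.Eventually.of_forall fun q => ?_)
  rw [Real.norm_of_nonneg (sq_nonneg _), ← mul_pow, ← sq_abs, ← Real.norm_eq_abs]
  gcongr
  exact (fderiv ℝ F q.1).le_opNorm q.2

/-- Rotation invariance for each angle, integrated over the angles. -/
theorem integrable_comp_rot (hsym : ∀ v w, B v w = B w v) (hc : 0 < c)
    (hB : ∀ v, c * ‖v‖ ^ 2 ≤ B v v) {G : E × E → ℝ} (hG : Continuous G)
    (hGi : Integrable G ((gaussianOf μ B).prod (gaussianOf μ B))) :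
    Integrable (fun z : ℝ × (E × E) => G (rot z.1 z.2))
      ((volume.restrict (Set.Ioc 0 (Real.pi / 2))).prod
        ((gaussianOf μ B).prod (gaussianOf μ B))) := by
  have := isProbabilityMeasure_gaussianOf (μ := μ) hc hB
  have hcont : Continuous fun z : ℝ × (E × E) => G (rot z.1 z.2) :=
    hG.comp continuous_rot_uncurry
  rw [integrable_prod_iff hcont.aestronglyMeasurable]
  refine ⟨Filter.Eventually.of_forall fun θ =>
    ((measurePreserving_rot hsym θ).integrable_comp hG.aestronglyMeasurable).2 hGi, ?_⟩
  have : ∀ θ : ℝ, ∫ p, ‖G (rot θ p)‖ ∂((gaussianOf μ B).prod (gaussianOf μ B))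
      = ∫ p, ‖G p‖ ∂((gaussianOf μ B).prod (gaussianOf μ B)) := by
    intro θ
    have h := measurePreserving_rot (μ := μ) hsym θ
    conv_rhs => rw [← h.map_eq]
    rw [integral_map h.aemeasurable hG.norm.aestronglyMeasurable]
  simp only [this]
  exact integrable_const _

/-- The difference of the values at two independent points is square integrable as soon as the
derivative is: it is the integral of the derivative along a quarter circle, and every point of that
circle together with its velocity has the law of two independent points. -/
theorem memLp_sub_prod (hsym : ∀ v w, B v w = B w v) (hc : 0 < c)
    (hB : ∀ v, c * ‖v‖ ^ 2 ≤ B v v) {F : E → ℝ}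
    (hF : ContDiff ℝ 1 F) (hF2 : MemLp (fderiv ℝ F) 2 (gaussianOf μ B)) :
    MemLp (fun p : E × E => F p.2 - F p.1) 2 ((gaussianOf μ B).prod (gaussianOf μ B)) := by
  have := isProbabilityMeasure_gaussianOf (μ := μ) hc hB
  have hdF := hF.continuous_fderiv one_ne_zero
  have hFc := hF.continuous
  have hcont : Continuous fun q : E × E => fderiv ℝ F q.1 q.2 := by fun_prop
  have hcD : Continuous fun p : E × E => F p.2 - F p.1 := by fun_prop
  rw [memLp_two_iff_integrable_sq hcD.aestronglyMeasurable]
  have hi := (integrable_comp_rot hsym hc hB (hcont.pow 2)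
    (memLp_fderiv_apply_prod (μ := μ) hc hB hF hF2).integrable_sq).integral_prod_right
  refine (hi.const_mul ((volume.restrict (Set.Ioc 0 (Real.pi / 2))).real Set.univ)).mono'
    (hcD.pow 2).aestronglyMeasurable (Filter.Eventually.of_forall fun p => ?_)
  rw [Real.norm_of_nonneg (sq_nonneg _), ← integral_fderiv_rot hF p,
    intervalIntegral.integral_of_le (by positivity)]
  refine sq_integral_le ?_
  have hcθ : Continuous fun θ => fderiv ℝ F (rot θ p).1 (rot θ p).2 := by
    simp only [rot_apply]; fun_prop
  rw [memLp_two_iff_integrable_sq hcθ.aestronglyMeasurable]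
  exact ((hcθ.pow 2).integrableOn_Icc).mono_set Set.Ioc_subset_Icc_self

/-- Freezing one of the two points at a typical value turns the square integrability of the
difference into that of the function. -/
theorem memLp_of_memLp_fderiv (hsym : ∀ v w, B v w = B w v) (hc : 0 < c)
    (hB : ∀ v, c * ‖v‖ ^ 2 ≤ B v v) {F : E → ℝ}
    (hF : ContDiff ℝ 1 F) (hF2 : MemLp (fderiv ℝ F) 2 (gaussianOf μ B)) :
    MemLp F 2 (gaussianOf μ B) := by
  have := isProbabilityMeasure_gaussianOf (μ := μ) hc hB
  have hFc := hF.continuous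
  obtain ⟨x, hx⟩ := (memLp_sub_prod hsym hc hB hF hF2).integrable_sq.prod_right_ae.exists
  have h1 : MemLp (fun y => F y - F x) 2 (gaussianOf μ B) := by
    rwa [memLp_two_iff_integrable_sq (by fun_prop)]
  exact (h1.add (memLp_const (F x))).ae_eq (Filter.Eventually.of_forall fun y => by simp)

/-- For fixed angle, integration by parts in the velocity variable. -/
theorem integral_mul_fderiv_rot (hsym : ∀ v w, B v w = B w v) (hc : 0 < c)
    (hB : ∀ v, c * ‖v‖ ^ 2 ≤ B v v) {T : (E →L[ℝ] ℝ) →L[ℝ] E} (hT : ∀ ℓ, B (T ℓ) = ℓ)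
    {F H : E → ℝ} (hF : ContDiff ℝ 1 F) (hH : ContDiff ℝ 1 H)
    (hF2 : MemLp (fderiv ℝ F) 2 (gaussianOf μ B)) (hH2 : MemLp (fderiv ℝ H) 2 (gaussianOf μ B))
    (θ : ℝ) :
    ∫ p : E × E, F p.1 * fderiv ℝ H (rot θ p).1 (rot θ p).2
        ∂((gaussianOf μ B).prod (gaussianOf μ B))
      = -Real.sin θ * ∫ p : E × E, fderiv ℝ F p.1 (T (fderiv ℝ H (rot θ p).1))
        ∂((gaussianOf μ B).prod (gaussianOf μ B)) := by
  have := isProbabilityMeasure_gaussianOf (μ := μ) hc hB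
  set γ := gaussianOf μ B with hγ
  have hFL := memLp_of_memLp_fderiv hsym hc hB hF hF2
  have hdF := hF.continuous_fderiv one_ne_zero
  have hdH := hH.continuous_fderiv one_ne_zero
  have hFc := hF.continuous
  -- Pass to the rotated variables `q = rot θ p`.
  have hrot : ∀ G : E × E → ℝ, Continuous G →
      ∫ p, G p ∂(γ.prod γ) = ∫ q, G (rot (-θ) q) ∂(γ.prod γ) := by
    intro G hG
    have h := measurePreserving_rot (μ := μ) hsym (-θ)
    conv_lhs => rw [← h.map_eq]
    rw [integral_map h.aemeasurable hG.aestronglyMeasurable]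
  have hback : ∀ q : E × E, rot θ (rot (-θ) q) = q := fun q => by
    simpa using rot_neg_rot (-θ) q
  have hmp := measurePreserving_rot (μ := μ) hsym (-θ)
  have hfst := measurePreserving_fst (μ := γ) (ν := γ)
  have hc1 : Continuous fun p : E × E => F p.1 * fderiv ℝ H (rot θ p).1 (rot θ p).2 := by
    simp only [rot_apply]; fun_prop
  have hc2 : Continuous fun p : E × E => fderiv ℝ F p.1 (T (fderiv ℝ H (rot θ p).1)) := by
    simp only [rot_apply]; fun_prop
  rw [hrot _ hc1, hrot _ hc2]
  simp only [hback]
  have hF1 : MemLp (fun q => F (rot (-θ) q).1) 2 (γ.prod γ) :=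
    (hFL.comp_measurePreserving hfst).comp_measurePreserving hmp
  have hdF1 : MemLp (fun q => fderiv ℝ F (rot (-θ) q).1) 2 (γ.prod γ) :=
    (hF2.comp_measurePreserving hfst).comp_measurePreserving hmp
  have hI1 : Integrable (fun q : E × E => F (rot (-θ) q).1 * fderiv ℝ H q.1 q.2) (γ.prod γ) :=
    hF1.integrable_mul (memLp_fderiv_apply_prod hc hB hH hH2)
  have hTH : MemLp (fun q : E × E => T (fderiv ℝ H q.1)) 2 (γ.prod γ) :=
    T.comp_memLp' (hH2.comp_measurePreserving hfst)
  have hI2 : Integrable (fun q : E × E => fderiv ℝ F (rot (-θ) q).1 (T (fderiv ℝ H q.1)))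
      (γ.prod γ) := by
    refine (hdF1.norm.integrable_mul hTH.norm).mono' ?_
      (Filter.Eventually.of_forall fun q => (fderiv ℝ F (rot (-θ) q).1).le_opNorm _)
    have : Continuous fun q : E × E => fderiv ℝ F (rot (-θ) q).1 (T (fderiv ℝ H q.1)) := by
      simp only [rot_apply]; fun_prop
    exact this.aestronglyMeasurable
  rw [integral_prod _ hI1, integral_prod _ hI2, ← integral_const_mul]
  refine integral_congr_ae ?_
  filter_upwards [hF1.integrable_sq.prod_right_ae, hI2.prod_right_ae] with u hu1 hu2
  have hgd : ContDiff ℝ 1 fun v => F (rot (-θ) (u, v)).1 := by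
    simp only [rot_apply]; fun_prop
  have hfd : ∀ v w, fderiv ℝ (fun v => F (rot (-θ) (u, v)).1) v w
      = -Real.sin θ * fderiv ℝ F (rot (-θ) (u, v)).1 w := by
    intro v w
    have h1 : HasFDerivAt (fun v : E => (rot (-θ) (u, v)).1)
        (-Real.sin θ • ContinuousLinearMap.id ℝ E) v := by
      simp only [rot_apply, Real.sin_neg]
      exact ((hasFDerivAt_id v).const_smul (-Real.sin θ)).const_add _
    have h2 := (hF.differentiable one_ne_zero (rot (-θ) (u, v)).1).hasFDerivAt.comp v h1
    have h3 := h2.fderiv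
    simp only [Function.comp_def] at h3
    rw [h3]
    simp
  -- Since `B (T ℓ) = ℓ`, the velocity enters through `B w` with `w = T (dH u)`.
  have := integral_mul_form_gaussianOf (μ := μ) hsym hc hB hgd
    ((memLp_two_iff_integrable_sq hgd.continuous.aestronglyMeasurable).2 hu1)
    (T (fderiv ℝ H u)) (by simp only [hfd]; exact hu2.const_mul _)
  rw [hT] at this
  simp only [hfd] at this
  rw [integral_const_mul] at this
  exact this

/-- A covariance under a Gaussian measure is an average, over a quarter circle of rotations, of the
derivatives paired through the covariance operator `T`. -/
theorem covariance_gaussianOf (hsym : ∀ v w, B v w = B w v) (hc : 0 < c)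
    (hB : ∀ v, c * ‖v‖ ^ 2 ≤ B v v) {T : (E →L[ℝ] ℝ) →L[ℝ] E} (hT : ∀ ℓ, B (T ℓ) = ℓ)
    {F H : E → ℝ} (hF : ContDiff ℝ 1 F) (hH : ContDiff ℝ 1 H)
    (hF2 : MemLp (fderiv ℝ F) 2 (gaussianOf μ B)) (hH2 : MemLp (fderiv ℝ H) 2 (gaussianOf μ B)) :
    cov[F, H; gaussianOf μ B] = ∫ θ in (0 : ℝ)..Real.pi / 2, Real.sin θ *
      ∫ p : E × E, fderiv ℝ F p.1 (T (fderiv ℝ H (rot θ p).1))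
        ∂((gaussianOf μ B).prod (gaussianOf μ B)) := by
  have := isProbabilityMeasure_gaussianOf (μ := μ) hc hB
  set γ := gaussianOf μ B with hγ
  have hFL := memLp_of_memLp_fderiv hsym hc hB hF hF2
  have hHL := memLp_of_memLp_fderiv hsym hc hB hH hH2
  have hdH := hH.continuous_fderiv one_ne_zero
  have hFc := hF.continuous
  have hFH : Integrable (fun x => F x * H x) γ := hFL.integrable_mul hHL
  have hFH1 : Integrable (fun p : E × E => F p.1 * H p.1) (γ.prod γ) :=
    (measurePreserving_fst (μ := γ) (ν := γ)).integrable_comp_of_integrable hFH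
  have hFH2 : Integrable (fun p : E × E => F p.1 * H p.2) (γ.prod γ) :=
    (hFL.integrable one_le_two).mul_prod (hHL.integrable one_le_two)
  -- Write the product of the means as an integral over two independent copies.
  have hcov : cov[F, H; γ] = -∫ p : E × E, F p.1 * (H p.2 - H p.1) ∂(γ.prod γ) := by
    simp only [mul_sub]
    rw [covariance_eq_sub hFL hHL, integral_sub hFH2 hFH1, integral_prod_mul, integral_prod _ hFH1]
    simp [hγ]
  rw [hcov]
  simp only [← integral_fderiv_rot hH, ← intervalIntegral.integral_const_mul]
  simp only [intervalIntegral.integral_of_le (show (0 : ℝ) ≤ Real.pi / 2 by positivity)]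
  have hcH : Continuous fun q : E × E => fderiv ℝ H q.1 q.2 := by fun_prop
  -- Fubini applies by `|a b| ≤ a² + b²`.
  have hint : Integrable (fun z : ℝ × (E × E) =>
      F z.2.1 * fderiv ℝ H (rot z.1 z.2).1 (rot z.1 z.2).2)
      ((volume.restrict (Set.Ioc 0 (Real.pi / 2))).prod (γ.prod γ)) := by
    have h1 := integrable_comp_rot hsym hc hB (hcH.pow 2)
      (memLp_fderiv_apply_prod (μ := μ) hc hB hH hH2).integrable_sq
    have h2 : Integrable (fun z : ℝ × (E × E) => F z.2.1 ^ 2)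
        ((volume.restrict (Set.Ioc 0 (Real.pi / 2))).prod (γ.prod γ)) :=
      ((measurePreserving_fst (μ := γ) (ν := γ)).integrable_comp_of_integrable
        hFL.integrable_sq).comp_snd _
    have hc1 : Continuous fun z : ℝ × (E × E) =>
        F z.2.1 * fderiv ℝ H (rot z.1 z.2).1 (rot z.1 z.2).2 := by
      simp only [rot_apply]; fun_prop
    refine (h2.add h1).mono' hc1.aestronglyMeasurable (Filter.Eventually.of_forall fun z => ?_)
    simp only [Pi.add_apply, Pi.pow_apply, Real.norm_eq_abs, abs_le]
    constructor <;> nlinarith [sq_nonneg (F z.2.1 - fderiv ℝ H (rot z.1 z.2).1 (rot z.1 z.2).2),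
      sq_nonneg (F z.2.1 + fderiv ℝ H (rot z.1 z.2).1 (rot z.1 z.2).2)]
  rw [← integral_integral_swap (f := fun (θ : ℝ) (p : E × E) =>
    F p.1 * fderiv ℝ H (rot θ p).1 (rot θ p).2) hint, ← integral_neg]
  congr 1
  funext θ
  rw [integral_mul_fderiv_rot hsym hc hB hT hF hH hF2 hH2 θ]
  ring

end Gaussian

/-! ### Distances on the torus -/

section Lattice

variable {d L : ℕ}

theorem siteDist_add_single_le [NeZero L] (x y : Site d L) (i : Fin d) (s : ZMod L)
    (hs : s.valMinAbs.natAbs ≤ 1) : siteDist (x + Pi.single i s) y ≤ siteDist x y + 1 := by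
  have h : ∀ j, ((x + Pi.single i s : Site d L) j - y j).valMinAbs.natAbs
      ≤ (x j - y j).valMinAbs.natAbs + if j = i then 1 else 0 := by
    intro j
    by_cases hj : j = i
    · subst hj
      rw [Pi.add_apply, Pi.single_eq_same, if_pos rfl, add_sub_right_comm]
      exact (ZMod.natAbs_valMinAbs_add_le _ _).trans
        ((Int.natAbs_add_le _ _).trans (by gcongr))
    · simp [hj]
  calc siteDist (x + Pi.single i s) y
      ≤ ∑ j, ((x j - y j).valMinAbs.natAbs + if j = i then 1 else 0) :=
        Finset.sum_le_sum fun j _ => h j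
    _ = siteDist x y + 1 := by simp [Finset.sum_add_distrib, siteDist]

theorem natAbs_valMinAbs_one_le [NeZero L] : (1 : ZMod L).valMinAbs.natAbs ≤ 1 := by
  rw [ZMod.valMinAbs_natAbs_eq_min]
  have : (1 : ZMod L).val ≤ 1 := by
    have := ZMod.val_natCast L 1
    rw [Nat.cast_one] at this
    rw [this]
    exact Nat.mod_le _ _
  omega

theorem siteDist_src_tgt_le [NeZero L] (e : PosEdge d L) (y : Site d L) :
    siteDist e.src y ≤ siteDist e.tgt y + 1 ∧ siteDist e.tgt y ≤ siteDist e.src y + 1 := by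
  refine ⟨?_, siteDist_add_single_le _ _ _ _ natAbs_valMinAbs_one_le⟩
  have h := siteDist_add_single_le e.tgt y e.2 (-1)
    (by rw [ZMod.natAbs_valMinAbs_neg]; exact natAbs_valMinAbs_one_le)
  rwa [show e.tgt + Pi.single e.2 (-1) = e.src by
    simp [PosEdge.tgt, PosEdge.src, add_assoc, ← Pi.single_add]] at h

theorem setDist_le {A S : Set (Site d L)} {x y : Site d L} (hx : x ∈ A) (hy : y ∈ S) :
    setDist A S ≤ siteDist x y := Nat.sInf_le ⟨x, hx, y, hy, rfl⟩

theorem exists_setDist_eq {A S : Set (Site d L)} (hA : A.Nonempty) (hS : S.Nonempty) :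
    ∃ x ∈ A, ∃ y ∈ S, setDist A S = siteDist x y := by
  obtain ⟨x, hx⟩ := hA
  obtain ⟨y, hy⟩ := hS
  exact Nat.sInf_mem (s := {n : ℕ | ∃ x ∈ A, ∃ y ∈ S, n = siteDist x y}) ⟨_, x, hx, y, hy, rfl⟩

theorem setDist_empty_right (A : Set (Site d L)) : setDist A ∅ = 0 := by
  simp [setDist]

theorem setDist_singleton_le_add_one {S : Set (Site d L)} {x x' : Site d L}
    (h : ∀ y, siteDist x y ≤ siteDist x' y + 1) : setDist {x} S ≤ setDist {x'} S + 1 := by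
  rcases S.eq_empty_or_nonempty with rfl | hS
  · simp [setDist_empty_right]
  · obtain ⟨_, rfl, y, hy, h1⟩ := exists_setDist_eq (Set.singleton_nonempty x') hS
    rw [h1]
    exact (setDist_le (Set.mem_singleton x) hy).trans (h y)

theorem setDist_singleton_of_mem {S : Set (Site d L)} {x : Site d L} (hx : x ∈ S) :
    setDist {x} S = 0 := by
  have := setDist_le (Set.mem_singleton x) hx
  simpa [siteDist] using this

theorem setDist_le_setDist_singleton {A S : Set (Site d L)} {x : Site d L} (hx : x ∈ A) :
    setDist A S ≤ setDist {x} S := by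
  rcases S.eq_empty_or_nonempty with rfl | hS
  · simp [setDist_empty_right]
  · obtain ⟨_, rfl, y, hy, h1⟩ := exists_setDist_eq (Set.singleton_nonempty x) hS
    exact h1 ▸ setDist_le hx hy

theorem sum_ite_src_eq [NeZero L] (x : Site d L) (a : ℝ) :
    ∑ e : PosEdge d L, (if e.src = x then a else 0) = d * a := by
  rw [Fintype.sum_prod_type_right]
  have h : ∀ i : Fin d, ∑ y : Site d L, (if PosEdge.src (y, i) = x then a else 0) = a :=
    fun i => (Finset.sum_ite_eq' Finset.univ x fun _ => a).trans (if_pos (Finset.mem_univ x))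
  simp [h]

theorem sum_ite_tgt_eq [NeZero L] (x : Site d L) (a : ℝ) :
    ∑ e : PosEdge d L, (if e.tgt = x then a else 0) = d * a := by
  rw [Fintype.sum_prod_type_right]
  simp [PosEdge.tgt, ← eq_sub_iff_add_eq]

end Lattice

/-! ### The action form and the decay of its inverse -/

section Action

variable {d L N : ℕ}

theorem norm_toEuclideanLin_of_mem {M : Matrix (Fin N) (Fin N) ℝ}
    (hM : M ∈ Matrix.specialOrthogonalGroup (Fin N) ℝ) (a : EuclideanSpace ℝ (Fin N)) :
    ‖Matrix.toEuclideanLin M a‖ = ‖a‖ := by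
  have h1 : M.transpose * M = 1 :=
    (Matrix.mem_orthogonalGroup_iff' (Fin N) ℝ).1 (Matrix.mem_specialOrthogonalGroup_iff.1 hM).1
  have h2 : inner ℝ (Matrix.toEuclideanLin M a) (Matrix.toEuclideanLin M a) = inner ℝ a a := by
    rw [← LinearMap.adjoint_inner_right, ← Matrix.toEuclideanLin_conjTranspose_eq_adjoint]
    congr 1
    simp [Matrix.toLpLin_apply, Matrix.mulVec_mulVec, h1]
  rw [real_inner_self_eq_norm_sq, real_inner_self_eq_norm_sq] at h2
  exact (pow_left_inj₀ (norm_nonneg _) (norm_nonneg _) two_ne_zero).1 h2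

/-- The covariant difference `Q_e Φ_y - Φ_x` along the edge `e = (x, y)`. -/
noncomputable def edgeDiff (Q : GaugeField d L N) (e : PosEdge d L) :
    HiggsField d L N →L[ℝ] EuclideanSpace ℝ (Fin N) :=
  (Matrix.toEuclideanLin (Q e : Matrix (Fin N) (Fin N) ℝ)).toContinuousLinearMap ∘L
    (ContinuousLinearMap.proj e.tgt : HiggsField d L N →L[ℝ] EuclideanSpace ℝ (Fin N))
    - (ContinuousLinearMap.proj e.src : HiggsField d L N →L[ℝ] EuclideanSpace ℝ (Fin N))

theorem edgeDiff_apply (Q : GaugeField d L N) (e : PosEdge d L) (Φ : HiggsField d L N) :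
    edgeDiff Q e Φ
      = Matrix.toEuclideanLin (Q e : Matrix (Fin N) (Fin N) ℝ) (Φ e.tgt) - Φ e.src := rfl

variable [NeZero L]

/-- The symmetric bilinear form whose quadratic form is twice the Higgs action. -/
noncomputable def actionForm (κ m : ℝ) (Q : GaugeField d L N) :
    HiggsField d L N →L[ℝ] HiggsField d L N →L[ℝ] ℝ :=
  (2 * κ * N) • ∑ e : PosEdge d L,
      ContinuousLinearMap.bilinearComp (innerSL ℝ) (edgeDiff Q e) (edgeDiff Q e)
    + (2 * m * N) • ∑ z : Site d L, ContinuousLinearMap.bilinearComp (innerSL ℝ)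
      (ContinuousLinearMap.proj z : HiggsField d L N →L[ℝ] EuclideanSpace ℝ (Fin N))
      (ContinuousLinearMap.proj z : HiggsField d L N →L[ℝ] EuclideanSpace ℝ (Fin N))

theorem actionForm_apply (κ m : ℝ) (Q : GaugeField d L N) (v w : HiggsField d L N) :
    actionForm κ m Q v w = 2 * κ * N * ∑ e, inner ℝ (edgeDiff Q e v) (edgeDiff Q e w)
      + 2 * m * N * ∑ z, inner ℝ (v z) (w z) := by
  simp [actionForm]

theorem actionForm_symm (κ m : ℝ) (Q : GaugeField d L N) (v w : HiggsField d L N) :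
    actionForm κ m Q v w = actionForm κ m Q w v := by
  simp only [actionForm_apply, real_inner_comm]

theorem actionForm_self (κ m : ℝ) (Q : GaugeField d L N) (Φ : HiggsField d L N) :
    actionForm κ m Q Φ Φ = 2 * higgsAction κ m Q Φ := by
  simp only [actionForm_apply, higgsAction, real_inner_self_eq_norm_sq, edgeDiff_apply]
  ring

theorem higgsMeasure_eq_gaussianOf (κ m : ℝ) (Q : GaugeField d L N) :
    higgsMeasure κ m Q = gaussianOf volume (actionForm κ m Q) := by
  unfold higgsMeasure gaussianOf
  congr 1
  funext Φ
  rw [actionForm_self]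
  ring

theorem actionForm_coercive {κ m : ℝ} (hκ : 0 < κ) (hm : 0 < m) (Q : GaugeField d L N)
    (Φ : HiggsField d L N) : 2 * m * N * ‖Φ‖ ^ 2 ≤ actionForm κ m Q Φ Φ := by
  have hsum : ‖Φ‖ ^ 2 ≤ ∑ z, ‖Φ z‖ ^ 2 := by
    have h0 : 0 ≤ ∑ z, ‖Φ z‖ ^ 2 := Finset.sum_nonneg fun z _ => sq_nonneg _
    rw [← Real.le_sqrt (norm_nonneg _) h0, pi_norm_le_iff_of_nonneg (Real.sqrt_nonneg _)]
    intro z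
    refine Real.le_sqrt_of_sq_le ?_
    exact Finset.single_le_sum (f := fun z => ‖Φ z‖ ^ 2) (fun z _ => sq_nonneg _)
      (Finset.mem_univ z)
  rw [actionForm_apply]
  simp only [real_inner_self_eq_norm_sq]
  have h1 : 0 ≤ 2 * κ * N * ∑ e, ‖edgeDiff Q e Φ‖ ^ 2 := by positivity
  have h2 : 2 * m * N * ‖Φ‖ ^ 2 ≤ 2 * m * N * ∑ z, ‖Φ z‖ ^ 2 := by gcongr
  linarith

/-- If `w x` dominates `w` at the neighbours of `x` up to the factor `t`, then testing the action
form of `w` against `w x` placed at the site `x` loses at most `t - 1` per edge at `x`. -/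
theorem le_actionForm_single {κ m t : ℝ} (hκ : 0 < κ) (Q : GaugeField d L N)
    (w : HiggsField d L N) (x : Site d L)
    (hx : ∀ e : PosEdge d L, (e.tgt = x → ‖w e.src‖ ≤ t * ‖w x‖) ∧
      (e.src = x → ‖w e.tgt‖ ≤ t * ‖w x‖)) :
    (2 * m * N - 4 * d * κ * N * (t - 1)) * ‖w x‖ ^ 2
      ≤ actionForm κ m Q w (Pi.single x (w x)) := by
  have hnorm : ∀ e a, ‖Matrix.toEuclideanLin (Q e : Matrix (Fin N) (Fin N) ℝ) a‖ = ‖a‖ :=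
    fun e a => norm_toEuclideanLin_of_mem (Q e).2 a
  have hedge : ∀ e : PosEdge d L,
      (if e.tgt = x then (1 - t) * ‖w x‖ ^ 2 else 0)
        + (if e.src = x then (1 - t) * ‖w x‖ ^ 2 else 0)
      ≤ inner ℝ (edgeDiff Q e w) (edgeDiff Q e (Pi.single x (w x))) := by
    intro e
    rw [edgeDiff_apply Q e (Pi.single x (w x)), inner_sub_right]
    have h1 : (if e.tgt = x then (1 - t) * ‖w x‖ ^ 2 else 0)
        ≤ inner ℝ (edgeDiff Q e w) (Matrix.toEuclideanLin (Q e : Matrix (Fin N) (Fin N) ℝ)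
          ((Pi.single x (w x) : HiggsField d L N) e.tgt)) := by
      split_ifs with h
      · rw [h, Pi.single_eq_same, edgeDiff_apply, h, inner_sub_left, real_inner_self_eq_norm_sq,
          hnorm]
        have h2 := real_inner_le_norm (w e.src)
          (Matrix.toEuclideanLin (Q e : Matrix (Fin N) (Fin N) ℝ) (w x))
        rw [hnorm] at h2
        nlinarith [mul_le_mul_of_nonneg_right ((hx e).1 h) (norm_nonneg (w x))]
      · rw [Pi.single_eq_of_ne h]; simp
    have h2 : (if e.src = x then (1 - t) * ‖w x‖ ^ 2 else 0)
        ≤ -inner ℝ (edgeDiff Q e w) ((Pi.single x (w x) : HiggsField d L N) e.src) := by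
      split_ifs with h
      · rw [h, Pi.single_eq_same, edgeDiff_apply, h, inner_sub_left, real_inner_self_eq_norm_sq]
        have h2 := real_inner_le_norm
          (Matrix.toEuclideanLin (Q e : Matrix (Fin N) (Fin N) ℝ) (w e.tgt)) (w x)
        rw [hnorm] at h2
        nlinarith [mul_le_mul_of_nonneg_right ((hx e).2 h) (norm_nonneg (w x))]
      · rw [Pi.single_eq_of_ne h]; simp
    linarith
  have hsum := Finset.sum_le_sum fun e (_ : e ∈ Finset.univ) => hedge e
  rw [Finset.sum_add_distrib, sum_ite_tgt_eq, sum_ite_src_eq] at hsum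
  have hdiag : ∑ z, inner ℝ (w z) ((Pi.single x (w x) : HiggsField d L N) z) = ‖w x‖ ^ 2 := by
    rw [Finset.sum_eq_single x]
    · simp
    · intro z _ hz; simp [Pi.single_eq_of_ne hz]
    · simp
  rw [actionForm_apply, hdiag]
  have := mul_le_mul_of_nonneg_left hsum (show 0 ≤ 2 * κ * (N : ℝ) by positivity)
  linarith

/-- Decay of the solution `w` of the covariant lattice equation `actionForm w = ℓ` away from the
sites carrying `ℓ` (Combes-Thomas bound), by the maximum principle for the weighted norms
`t ^ D z * ‖w z‖`. Here `t` is chosen such that the mass term still dominates. -/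
theorem pow_mul_norm_le_of_actionForm {κ m t : ℝ} (hκ : 0 < κ) (hm : 0 < m) (hN : 1 ≤ N)
    (ht : 1 ≤ t) (htm : 4 * d * κ * (t - 1) ≤ m) (Q : GaugeField d L N) {w : HiggsField d L N}
    {D : Site d L → ℕ}
    (hD : ∀ e : PosEdge d L, D e.src ≤ D e.tgt + 1 ∧ D e.tgt ≤ D e.src + 1)
    {a : Site d L → ℝ} (ha : ∀ x, 0 ≤ a x) (haD : ∀ x, D x ≠ 0 → a x = 0)
    (hw : ∀ x v, actionForm κ m Q w (Pi.single x v) ≤ a x * ‖v‖) (z : Site d L) :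
    t ^ D z * ‖w z‖ ≤ (m * N)⁻¹ * ∑ y, a y := by
  have ht0 : 0 < t := by linarith
  have hN' : (1 : ℝ) ≤ N := by exact_mod_cast hN
  have hmN : 0 < m * N := by positivity
  -- At a maximum `x` of the weighted norm, `w` at the neighbours is at most `t * ‖w x‖`.
  obtain ⟨x, hx⟩ := Finite.exists_max fun z => t ^ D z * ‖w z‖
  have hcmp : ∀ y, D x ≤ D y + 1 → ‖w y‖ ≤ t * ‖w x‖ := by
    intro y hy
    have h1 : t ^ D y * ‖w y‖ ≤ t ^ D y * (t * ‖w x‖) := by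
      rw [← mul_assoc, ← pow_succ]
      exact (hx y).trans (by gcongr)
    exact le_of_mul_le_mul_left h1 (by positivity)
  have h1 := (le_actionForm_single (m := m) hκ Q w x (fun e =>
    ⟨fun h => hcmp _ (h ▸ (hD e).2), fun h => hcmp _ (h ▸ (hD e).1)⟩)).trans (hw x (w x))
  have h2 : m * N * ‖w x‖ ^ 2 ≤ a x * ‖w x‖ := by
    refine le_trans (mul_le_mul_of_nonneg_right ?_ (sq_nonneg _)) h1
    nlinarith
  have h3 : ‖w x‖ ≤ (m * N)⁻¹ * a x := by
    rcases (norm_nonneg (w x)).eq_or_lt with h0 | h0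
    · rw [← h0]; have := ha x; positivity
    · rw [le_inv_mul_iff₀ hmN]
      refine le_of_mul_le_mul_right ?_ h0
      linarith
  refine (hx z).trans ?_
  have hsum : a x ≤ ∑ y, a y := Finset.single_le_sum (fun y _ => ha y) (Finset.mem_univ x)
  -- Off the sites carrying `a`, the bound at `x` forces `w x = 0`, hence `w = 0`.
  by_cases hDx : D x = 0
  · rw [hDx, pow_zero, one_mul]
    exact h3.trans (by gcongr)
  · have h4 : ‖w x‖ ≤ 0 := by simpa [haD x hDx] using h3
    rw [le_antisymm h4 (norm_nonneg _), mul_zero]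
    exact mul_nonneg (by positivity) (Finset.sum_nonneg fun y _ => ha y)

end Action

/-! ### Sitewise gradients -/

section Gradient

variable {d L N : ℕ}

theorem fderiv_single [NeZero L] {F : HiggsField d L N → ℝ} (hF : ContDiff ℝ 1 F)
    (Φ : HiggsField d L N) (x : Site d L) (v : EuclideanSpace ℝ (Fin N)) :
    fderiv ℝ F Φ (Pi.single x v) = inner ℝ (gradAt F x Φ) v := by
  rw [gradAt, inner_gradient_left]
  have h1 := (hasFDerivAt_update (𝕜 := ℝ) Φ (i := x) (Φ x))
  have h2 : HasFDerivAt F (fderiv ℝ F Φ) (Function.update Φ x (Φ x)) := by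
    rw [Function.update_eq_self]
    exact (hF.differentiable one_ne_zero Φ).hasFDerivAt
  have h3 := (h2.comp (Φ x) h1).fderiv
  simp only [Function.comp_def] at h3
  rw [h3]
  simp only [ContinuousLinearMap.comp_apply]
  congr 1
  funext y
  by_cases h : y = x
  · subst h; simp
  · simp [h]

theorem fderiv_eq_sum [NeZero L] {F : HiggsField d L N → ℝ} (hF : ContDiff ℝ 1 F)
    (Φ v : HiggsField d L N) : fderiv ℝ F Φ v = ∑ x, inner ℝ (gradAt F x Φ) (v x) := by
  simp only [← fderiv_single hF, ← map_sum, Finset.univ_sum_single]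

theorem norm_fderiv_le [NeZero L] {F : HiggsField d L N → ℝ} (hF : ContDiff ℝ 1 F)
    (Φ : HiggsField d L N) : ‖fderiv ℝ F Φ‖ ≤ ∑ x, ‖gradAt F x Φ‖ := by
  refine ContinuousLinearMap.opNorm_le_bound _ (Finset.sum_nonneg fun x _ => norm_nonneg _)
    fun v => ?_
  rw [fderiv_eq_sum hF, Finset.sum_mul]
  refine (norm_sum_le _ _).trans (Finset.sum_le_sum fun x _ => ?_)
  exact (norm_inner_le_norm _ _).trans (by gcongr; exact norm_le_pi_norm v x)

theorem gradAt_eq_zero {F : HiggsField d L N → ℝ} {x : Site d L} (hx : x ∉ siteSupport F) :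
    gradAt F x = 0 := by
  funext Φ
  have : (fun v => F (Function.update Φ x v)) = fun _ => F Φ := by
    funext v
    by_contra h
    exact hx ⟨Φ, v, h⟩
  rw [gradAt, this]
  simp

end Gradient

/-! ### The covariance bound -/

/-- A coercive bilinear form on a finite-dimensional space is invertible. -/
theorem exists_inverse_form {E : Type*} [NormedAddCommGroup E] [NormedSpace ℝ E]
    [FiniteDimensional ℝ E] {B : E →L[ℝ] E →L[ℝ] ℝ} {c : ℝ} (hc : 0 < c)
    (hB : ∀ v, c * ‖v‖ ^ 2 ≤ B v v) : ∃ T : (E →L[ℝ] ℝ) →L[ℝ] E, ∀ ℓ, B (T ℓ) = ℓ := by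
  have hinj : Function.Injective B.toLinearMap := by
    rw [← LinearMap.ker_eq_bot, LinearMap.ker_eq_bot']
    intro v hv
    have h1 : B v v = 0 := by
      rw [show B v = 0 from hv]; simp
    have h2 := hB v
    rw [h1] at h2
    have h3 : ‖v‖ ^ 2 ≤ 0 := nonpos_of_mul_nonpos_right h2 hc
    exact norm_eq_zero.1 (pow_eq_zero_iff two_ne_zero |>.1 (le_antisymm h3 (sq_nonneg _)))
  have hdim : Module.finrank ℝ E = Module.finrank ℝ (E →L[ℝ] ℝ) := by
    rw [← (LinearMap.toContinuousLinearMap (𝕜 := ℝ) (E := E) (F' := ℝ)).finrank_eq]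
    exact (Subspace.dual_finrank_eq (K := ℝ) (V := E)).symm
  let e := B.toLinearMap.linearEquivOfInjective hinj hdim
  exact ⟨LinearMap.toContinuousLinearMap e.symm.toLinearMap, fun ℓ => e.apply_symm_apply ℓ⟩

theorem integral_norm_mul_norm_le {α E G : Type*} [MeasurableSpace α] {ν : Measure α}
    [NormedAddCommGroup E] [NormedAddCommGroup G] {f : α → E} {g : α → G}
    (hf : MemLp f 2 ν) (hg : MemLp g 2 ν) :
    ∫ a, ‖f a‖ * ‖g a‖ ∂ν ≤ (eLpNorm f 2 ν).toReal * (eLpNorm g 2 ν).toReal := by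
  have h1 : ∫ a, ‖f a‖ * ‖g a‖ ∂ν
      = (eLpNorm ((fun a => ‖f a‖) • fun a => ‖g a‖) 1 ν).toReal := by
    rw [eLpNorm_one_eq_lintegral_enorm, ← integral_norm_eq_lintegral_enorm
      (hf.norm.aestronglyMeasurable.smul hg.norm.aestronglyMeasurable)]
    simp
  rw [h1, ← ENNReal.toReal_mul, ← eLpNorm_norm f, ← eLpNorm_norm g]
  refine ENNReal.toReal_mono (ENNReal.mul_ne_top hf.norm.2.ne hg.norm.2.ne) ?_
  exact eLpNorm_smul_le_mul_eLpNorm hg.norm.1 hf.norm.1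

section Decay

variable {d L N : ℕ} [NeZero L]

theorem memLp_fderiv_of_memLp_gradAt {ν : Measure (HiggsField d L N)} {F : HiggsField d L N → ℝ}
    (hF : ContDiff ℝ 1 F) (hF2 : ∀ x, MemLp (gradAt F x) 2 ν) : MemLp (fderiv ℝ F) 2 ν := by
  have h : MemLp (fun Φ => ∑ x, ‖gradAt F x Φ‖) 2 ν :=
    memLp_finsetSum _ fun x _ => (hF2 x).norm
  exact h.mono (hF.continuous_fderiv one_ne_zero).aestronglyMeasurable
    (Filter.Eventually.of_forall fun Φ => (norm_fderiv_le hF Φ).trans (Real.le_norm_self _))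

/-- The gradients of `F` and `H`, paired through the inverse of the action form, decouple
exponentially in the distance of the supports. -/
theorem abs_fderiv_inverse_le {κ m t : ℝ} (hκ : 0 < κ) (hm : 0 < m) (hN : 1 ≤ N)
    (ht : 1 ≤ t) (htm : 4 * d * κ * (t - 1) ≤ m) (Q : GaugeField d L N)
    {F H : HiggsField d L N → ℝ} (hF : ContDiff ℝ 1 F) (hH : ContDiff ℝ 1 H)
    (Φ Ψ : HiggsField d L N) {w : HiggsField d L N} (hw : actionForm κ m Q w = fderiv ℝ H Ψ) :
    |fderiv ℝ F Φ w| ≤ (m * N)⁻¹ * (t ^ setDist (siteSupport F) (siteSupport H))⁻¹ *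
      ∑ x, ∑ y, ‖gradAt F x Φ‖ * ‖gradAt H y Ψ‖ := by
  have ht0 : 0 < t := by linarith
  have hw' := pow_mul_norm_le_of_actionForm hκ hm hN ht htm Q (w := w)
    (D := fun x => setDist {x} (siteSupport H)) (a := fun x => ‖gradAt H x Ψ‖)
    (fun e => ⟨setDist_singleton_le_add_one fun y => (siteDist_src_tgt_le e y).1,
      setDist_singleton_le_add_one fun y => (siteDist_src_tgt_le e y).2⟩)
    (fun x => norm_nonneg _)
    (fun x hx => by
      rw [gradAt_eq_zero fun h => hx (setDist_singleton_of_mem h)]; simp)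
    (fun x v => by rw [hw, fderiv_single hH]; exact real_inner_le_norm _ _)
  rw [fderiv_eq_sum hF, Finset.mul_sum]
  refine (Finset.abs_sum_le_sum_abs _ _).trans (Finset.sum_le_sum fun x _ => ?_)
  by_cases hx : x ∈ siteSupport F
  · have h1 : ‖w x‖ ≤ (t ^ setDist (siteSupport F) (siteSupport H))⁻¹ *
        ((m * N)⁻¹ * ∑ y, ‖gradAt H y Ψ‖) := by
      rw [le_inv_mul_iff₀ (by positivity)]
      refine le_trans ?_ (hw' x)
      gcongr
      exact setDist_le_setDist_singleton hx
    calc |inner ℝ (gradAt F x Φ) (w x)| ≤ ‖gradAt F x Φ‖ * ‖w x‖ := abs_real_inner_le_norm _ _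
      _ ≤ ‖gradAt F x Φ‖ * ((t ^ setDist (siteSupport F) (siteSupport H))⁻¹ *
        ((m * N)⁻¹ * ∑ y, ‖gradAt H y Ψ‖)) := by gcongr
      _ = _ := by rw [← Finset.mul_sum]; ring
  · simp [gradAt_eq_zero hx]

/-- The covariance bound in terms of the decay factor `t`. -/
theorem abs_covariance_gaussianOf_actionForm_le {κ m t : ℝ} (hκ : 0 < κ) (hm : 0 < m) (hN : 1 ≤ N)
    (ht : 1 ≤ t) (htm : 4 * d * κ * (t - 1) ≤ m) (Q : GaugeField d L N)
    {F H : HiggsField d L N → ℝ} (hF : ContDiff ℝ 1 F) (hH : ContDiff ℝ 1 H)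
    (hF2 : ∀ x, MemLp (gradAt F x) 2 (gaussianOf volume (actionForm κ m Q)))
    (hH2 : ∀ x, MemLp (gradAt H x) 2 (gaussianOf volume (actionForm κ m Q))) :
    |cov[F, H; gaussianOf volume (actionForm κ m Q)]| ≤
      Real.pi / 2 * ((m * N)⁻¹ * (t ^ setDist (siteSupport F) (siteSupport H))⁻¹ *
        (gradNorm (gaussianOf volume (actionForm κ m Q)) F *
          gradNorm (gaussianOf volume (actionForm κ m Q)) H)) := by
  have ht0 : 0 < t := by linarith
  have hc : 0 < 2 * m * (N : ℝ) := by
    have : (1 : ℝ) ≤ N := by exact_mod_cast hN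
    positivity
  have hB := actionForm_coercive hκ hm Q
  have hsym := actionForm_symm κ m Q
  obtain ⟨T, hT⟩ := exists_inverse_form hc hB
  have hprob := isProbabilityMeasure_gaussianOf (μ := volume) hc hB
  rw [covariance_gaussianOf hsym hc hB hT hF hH (memLp_fderiv_of_memLp_gradAt hF hF2)
    (memLp_fderiv_of_memLp_gradAt hH hH2)]
  set γ := gaussianOf volume (actionForm κ m Q) with hγ
  set A := (m * N)⁻¹ * (t ^ setDist (siteSupport F) (siteSupport H))⁻¹ with hA
  have hA0 : 0 ≤ A := by positivity
  have hθ : ∀ θ : ℝ, |∫ p, fderiv ℝ F p.1 (T (fderiv ℝ H (rot θ p).1)) ∂(γ.prod γ)|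
      ≤ A * (gradNorm γ F * gradNorm γ H) := by
    intro θ
    have hfst := measurePreserving_fst (μ := γ) (ν := γ)
    have hrot : MeasurePreserving (fun p => (rot θ p).1) (γ.prod γ) γ :=
      hfst.comp (measurePreserving_rot (μ := volume) hsym θ)
    have hFx : ∀ x, MemLp (fun p : HiggsField d L N × HiggsField d L N => gradAt F x p.1) 2
        (γ.prod γ) := fun x => (hF2 x).comp_measurePreserving hfst
    have hHy : ∀ y, MemLp (fun p : HiggsField d L N × HiggsField d L N =>
        gradAt H y (rot θ p).1) 2 (γ.prod γ) := fun y => (hH2 y).comp_measurePreserving hrot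
    have hFe : ∀ x, eLpNorm (fun p : HiggsField d L N × HiggsField d L N => gradAt F x p.1) 2
        (γ.prod γ) = eLpNorm (gradAt F x) 2 γ :=
      fun x => eLpNorm_comp_measurePreserving (hF2 x).1 hfst
    have hHe : ∀ y, eLpNorm (fun p : HiggsField d L N × HiggsField d L N =>
        gradAt H y (rot θ p).1) 2 (γ.prod γ) = eLpNorm (gradAt H y) 2 γ :=
      fun y => eLpNorm_comp_measurePreserving (hH2 y).1 hrot
    have hint : ∀ x y, Integrable (fun p : HiggsField d L N × HiggsField d L N =>
        ‖gradAt F x p.1‖ * ‖gradAt H y (rot θ p).1‖) (γ.prod γ) :=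
      fun x y => (hFx x).norm.integrable_mul (hHy y).norm
    rw [← Real.norm_eq_abs]
    refine (norm_integral_le_of_norm_le (g := fun p => A * ∑ x, ∑ y,
      ‖gradAt F x p.1‖ * ‖gradAt H y (rot θ p).1‖) ?_ (Filter.Eventually.of_forall fun p =>
        abs_fderiv_inverse_le hκ hm hN ht htm Q hF hH _ _ (hT _))).trans ?_
    · exact (integrable_finsetSum _ fun x _ => integrable_finsetSum _ fun y _ =>
        hint x y).const_mul _
    · rw [integral_const_mul, integral_finsetSum _ fun x _ => integrable_finsetSum _ fun y _ =>
        hint x y]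
      refine mul_le_mul_of_nonneg_left ?_ hA0
      rw [gradNorm, gradNorm, Finset.sum_mul_sum]
      refine Finset.sum_le_sum fun x _ => ?_
      rw [integral_finsetSum _ fun y _ => hint x y]
      refine Finset.sum_le_sum fun y _ => ?_
      rw [← hFe x, ← hHe y]
      exact integral_norm_mul_norm_le (hFx x) (hHy y)
  rw [← Real.norm_eq_abs]
  refine (intervalIntegral.norm_integral_le_of_norm_le_const
    (C := A * (gradNorm γ F * gradNorm γ H)) fun θ _ => ?_).trans_eq ?_
  · rw [norm_mul, Real.norm_eq_abs, Real.norm_eq_abs]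
    exact (mul_le_of_le_one_left (abs_nonneg _) (Real.abs_sin_le_one θ)).trans (hθ θ)
  · rw [sub_zero, abs_of_pos (by positivity)]; ring

theorem gradNorm_nonneg (ν : Measure (HiggsField d L N)) (F : HiggsField d L N → ℝ) :
    0 ≤ gradNorm ν F := Finset.sum_nonneg fun _ _ => ENNReal.toReal_nonneg

/-- For empty support both sides vanish; otherwise the cardinality is at least `1`. -/
theorem gradNorm_le_ncard_mul (ν : Measure (HiggsField d L N)) (F : HiggsField d L N → ℝ) :
    gradNorm ν F ≤ (siteSupport F).ncard * gradNorm ν F := by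
  rcases (siteSupport F).eq_empty_or_nonempty with h | h
  · have : gradNorm ν F = 0 := Finset.sum_eq_zero fun x _ => by
      rw [gradAt_eq_zero (by simp [h])]; simp
    simp [this]
  · have h1 : 1 ≤ (siteSupport F).ncard := (Set.ncard_pos (Set.toFinite _)).2 h
    exact le_mul_of_one_le_left (gradNorm_nonneg ν F) (by exact_mod_cast h1)

end Decay

/-! ### The decay rate -/

/-- The decay rate as a function of the curvature constant. Since `K = curvConst d N β κ m` is at
most `(N + 2) / 4 - 1 - κ N / m`, it controls the ratio `κ / m`, and with it the rate; the summand
`1` makes the rate positive also for those `K` that are no curvature constant. -/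
noncomputable def decayRate (d N : ℕ) (K : ℝ) : ℝ :=
  Real.log (1 + N / (4 * d * (|((N : ℝ) + 2) / 4 - 1 - K| + 1)))

theorem decayRate_pos {d N : ℕ} (hd : 1 ≤ d) (hN : 1 ≤ N) (K : ℝ) : 0 < decayRate d N K := by
  have hd' : (0 : ℝ) < d := by exact_mod_cast hd
  have hN' : (0 : ℝ) < N := by exact_mod_cast hN
  refine Real.log_pos (lt_add_of_pos_right _ ?_)
  positivity

theorem exp_decayRate_sub_one_le {d N : ℕ} (hd : 1 ≤ d) (β : ℝ) {κ m : ℝ}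
    (hκ : 0 < κ) (hm : 0 < m) :
    4 * d * κ * (Real.exp (decayRate d N (curvConst d N β κ m)) - 1) ≤ m := by
  have hd' : (1 : ℝ) ≤ d := by exact_mod_cast hd
  set K := curvConst d N β κ m with hK
  set M := |((N : ℝ) + 2) / 4 - 1 - K| + 1 with hM
  have hM0 : 0 < M := by positivity
  have hMκ : κ * N / m ≤ M := by
    have h1 : κ * N / m ≤ ((N : ℝ) + 2) / 4 - 1 - K := by
      have h2 : 0 ≤ 2 * κ ^ 2 * N / m ^ 2 := by positivity
      have h3 : 0 ≤ 8 * ((d : ℝ) - 1) * N * |β| :=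
        mul_nonneg (mul_nonneg (by linarith) (Nat.cast_nonneg N)) (abs_nonneg β)
      rw [hK, curvConst]
      linarith
    linarith [le_abs_self (((N : ℝ) + 2) / 4 - 1 - K)]
  rw [decayRate, Real.exp_log (by positivity), add_sub_cancel_left]
  rw [div_le_iff₀ hm] at hMκ
  rw [show 4 * (d : ℝ) * κ * (N / (4 * d * M)) = κ * N / M by field_simp, div_le_iff₀ hM0]
  linarith

end YMH

theorem lemma4p3 (d N : ℕ) (hd : 1 ≤ d) (hN : 1 ≤ N) :
    ∃ rate : ℝ → ℝ, (∀ K : ℝ, 0 < rate K) ∧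
      ∀ κ m : ℝ, 0 < κ → 0 < m →
        ∃ C : ℝ, 0 < C ∧
          ∀ (β : ℝ) (L : ℕ) [NeZero L] (Q : YMH.GaugeField d L N)
            (F H : YMH.HiggsField d L N → ℝ),
            ContDiff ℝ ∞ F → ContDiff ℝ ∞ H →
            Disjoint (YMH.siteSupport F) (YMH.siteSupport H) →
            (∀ x, MemLp (YMH.gradAt F x) 2 (YMH.higgsMeasure κ m Q)) →
            (∀ x, MemLp (YMH.gradAt H x) 2 (YMH.higgsMeasure κ m Q)) →
            IsProbabilityMeasure (YMH.higgsMeasure κ m Q) ∧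
            MemLp F 2 (YMH.higgsMeasure κ m Q) ∧
            MemLp H 2 (YMH.higgsMeasure κ m Q) ∧
            |cov[F, H; YMH.higgsMeasure κ m Q]| ≤
              C * (YMH.siteSupport F).ncard * (YMH.siteSupport H).ncard *
                Real.exp (-(rate (YMH.curvConst d N β κ m)) *
                  YMH.setDist (YMH.siteSupport F) (YMH.siteSupport H)) *
                YMH.gradNorm (YMH.higgsMeasure κ m Q) F *
                YMH.gradNorm (YMH.higgsMeasure κ m Q) H := by
  have hN' : (0 : ℝ) < N := by exact_mod_cast hN
  refine ⟨YMH.decayRate d N, YMH.decayRate_pos hd hN, fun κ m hκ hm =>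
    ⟨Real.pi / 2 * (m * N)⁻¹, by positivity, ?_⟩⟩
  intro β L _ Q F H hF hH _ hF2 hH2
  rw [YMH.higgsMeasure_eq_gaussianOf] at hF2 hH2 ⊢
  have hF1 : ContDiff ℝ 1 F := hF.of_le (by exact_mod_cast le_top)
  have hH1 : ContDiff ℝ 1 H := hH.of_le (by exact_mod_cast le_top)
  have hc : 0 < 2 * m * (N : ℝ) := by positivity
  have hB := YMH.actionForm_coercive hκ hm Q
  have hsym := YMH.actionForm_symm κ m Q
  refine ⟨YMH.isProbabilityMeasure_gaussianOf hc hB,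
    YMH.memLp_of_memLp_fderiv hsym hc hB hF1 (YMH.memLp_fderiv_of_memLp_gradAt hF1 hF2),
    YMH.memLp_of_memLp_fderiv hsym hc hB hH1 (YMH.memLp_fderiv_of_memLp_gradAt hH1 hH2), ?_⟩
  set r := YMH.decayRate d N (YMH.curvConst d N β κ m)
  have hr : 1 ≤ Real.exp r := Real.one_le_exp (YMH.decayRate_pos hd hN _).le
  have h1 := YMH.abs_covariance_gaussianOf_actionForm_le hκ hm hN hr
    (YMH.exp_decayRate_sub_one_le hd β hκ hm) Q hF1 hH1 hF2 hH2
  set γ := YMH.gaussianOf volume (YMH.actionForm κ m Q)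
  have hexp : (Real.exp r ^ YMH.setDist (YMH.siteSupport F) (YMH.siteSupport H))⁻¹
      = Real.exp (-r * YMH.setDist (YMH.siteSupport F) (YMH.siteSupport H)) := by
    rw [← Real.exp_nat_mul, ← Real.exp_neg]; congr 1; ring
  rw [hexp] at h1
  have h2 := mul_le_mul (YMH.gradNorm_le_ncard_mul γ F) (YMH.gradNorm_le_ncard_mul γ H)
    (YMH.gradNorm_nonneg γ H) (mul_nonneg (Nat.cast_nonneg _) (YMH.gradNorm_nonneg γ F))
  calc |cov[F, H; γ]| ≤ _ := h1
    _ ≤ Real.pi / 2 * ((m * N)⁻¹ *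
        Real.exp (-r * YMH.setDist (YMH.siteSupport F) (YMH.siteSupport H)) *
        ((YMH.siteSupport F).ncard * YMH.gradNorm γ F *
          ((YMH.siteSupport H).ncard * YMH.gradNorm γ H))) := by gcongr
    _ = _ := by ring
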